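/- Let $\mathbb K$ be a field and $S=\mathbb K[X_1,\dots,X_n]$, with its multigrading. For monomial ideals $J\subsetneq I\subseteq S$, a Stanley decomposition of $I/J$ is a finite family of homogeneous elements $\lambda_i\in I/J$ and sets of variables $Z_i\subseteq\{X_1,\dots,X_n\}$ such that each $\lambda_i\mathbb K[Z_i]$ is a free $\mathbb K[Z_i]$-module and $I/J=\bigoplus_i\lambda_i\mathbb K[Z_i]$ as a $\mathbb K$-vector space; $\operatorname{sdepth}_S I/J$ is the maximum of $\min_i|Z_i|$ over all Stanley decompositions. The depth of an $S$-module is taken with respect to the ideal $(X_1,\dots,X_n)$. A deformation of a finite set $G$ of monomials assigns to each $g=X^{a}\in G$ a vector $\varepsilon_g\in\mathbb N^n$ such that for all $g=X^{a}$ and $h=X^{b}$ in $G$ and all $j$: $a_j>b_j$ implies $a_j+(\varepsilon_g)_j>b_j+(\varepsilon_h)_j$, and $a_j=0$ implies $(\varepsilon_g)_j=0$. A monomial ideal is called generic if for any two distinct minimal monomial generators $m,m'$ having the same positive degree in some variable there is a third minimal generator $m''$ that strictly divides $\operatorname{lcm}(m,m')$, that is, $m''$ divides $\operatorname{lcm}(m,m')/X_j$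 for every variable $X_j$ dividing $\operatorname{lcm}(m,m')$. (1) Let $J\subsetneq I\subseteq S$ be monomial ideals with finite sets $G_I,G_J$ of monomial generators, let $\varepsilon$ be a deformation of $G_I\cup G_J$, and put $I_\varepsilon=(g\,X^{\varepsilon_g}: g\in G_I)$ and $J_\varepsilon=(g\,X^{\varepsilon_g}: g\in G_J)$. If $J_\varepsilon\subseteq I_\varepsilon$, then $J_\varepsilon\subsetneq I_\varepsilon$ and $$\operatorname{sdepth}_S I/J\ \ge\ \operatorname{sdepth}_S I_\varepsilon/J_\varepsilon .$$ (2) Let $I\subsetneq S$ be a monomial ideal with a finite set $G$ of monomial generators, let $\varepsilon$ be a deformation of $G$, and put $I_\varepsilon=(g\,X^{\varepsilon_g}: g\in G)$. If $I_\varepsilon$ is generic and $\operatorname{depth}_S S/I=\operatorname{depth}_S S/I_\varepsilon$, then $\operatorname{sdepth}_S S/I\ge\operatorname{depth}_S S/I$, i.e. the Stanley conjecture holds for $S/I$. -/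

import Mathlib

noncomputable section

namespace Stanley

open MvPolynomial

/-- The monomial `X^a` of `S = K[X_1, …, X_n]` with exponent vector `a`. -/
def mono (K : Type*) [Field K] {n : ℕ} (a : Fin n →₀ ℕ) : MvPolynomial (Fin n) K :=
  monomial a 1

/-- The monomial ideal of `S` generated by the finite set of monomials whose exponent vectors
form `G`. -/
def monomialIdeal (K : Type*) [Field K] {n : ℕ} (G : Finset (Fin n →₀ ℕ)) :
    Ideal (MvPolynomial (Fin n) K) :=
  Ideal.span (mono K '' (G : Set (Fin n →₀ ℕ)))

/-! ### Stanley depth -/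

section StanleyDepth

variable {K : Type*} [Field K] {n : ℕ} {M : Type*} [AddCommGroup M] [Module K M]
  [Module (MvPolynomial (Fin n) K) M] [IsScalarTower K (MvPolynomial (Fin n) K) M]

/-- For an `S`-module `M`, an element `u` and a set `Z` of variables, the `K`-subspace
`u K[Z] = {f • u | f ∈ K[Z]}` of `M`. -/
def stanleySpace (Z : Finset (Fin n)) (u : M) : Submodule K M :=
  (Subalgebra.toSubmodule (supported K (Z : Set (Fin n)))).map
    ((LinearMap.toSpanSingleton (MvPolynomial (Fin n) K) M u).restrictScalars K)

/-- `u K[Z]` is free over `K[Z]` (with basis `u`): only `f = 0` in `K[Z]` kills `u`. -/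
def StanleySpaceFree (K : Type*) [Field K] {n : ℕ} {M : Type*} [AddCommGroup M]
    [Module (MvPolynomial (Fin n) K) M] (Z : Finset (Fin n)) (u : M) : Prop :=
  ∀ f ∈ supported K (Z : Set (Fin n)), f • u = 0 → f = 0

/-- A Stanley decomposition of an `S`-module `M` with multigraded pieces `𝓜 a`: a finite family
of homogeneous elements `u i` and sets `Z i` of variables, with every `u i K[Z i]` free over
`K[Z i]`, such that `M` is the internal direct sum of the `u i K[Z i]` as a `K`-space. -/
structure IsStanleyDecomposition (𝓜 : (Fin n →₀ ℕ) → Submodule K M) {r : ℕ}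
    (Z : Fin r → Finset (Fin n)) (u : Fin r → M) : Prop where
  homogeneous : ∀ i, ∃ a, u i ∈ 𝓜 a
  free : ∀ i, StanleySpaceFree K (Z i) (u i)
  isInternal : DirectSum.IsInternal fun i => stanleySpace (K := K) (Z i) (u i)

/-- The Stanley depth of a multigraded module: the largest `min_i |Z i|` over all Stanley
decompositions (`|Z i|` is the depth of the `S`-module `u i K[Z i] ≅ S / (X_j : j ∉ Z i)`). -/
def stanleyDepth (𝓜 : (Fin n →₀ ℕ) → Submodule K M) : ℕ∞ :=
  sSup {d | ∃ (r : ℕ) (Z : Fin r → Finset (Fin n)) (u : Fin r → M),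
    IsStanleyDecomposition 𝓜 Z u ∧ d = ⨅ i, ((Z i).card : ℕ∞)}

end StanleyDepth

/-- The `S`-module `I / J` for ideals `J ≤ I` of `S`. -/
abbrev IdealQuot {K : Type*} [Field K] {n : ℕ} (I J : Ideal (MvPolynomial (Fin n) K)) : Type _ :=
  ↥I ⧸ Submodule.submoduleOf J I

/-- The multigrading of `I / J`: the piece of degree `a` consists of the classes of the scalar
multiples of `X^a` that lie in `I`. -/
def idealQuotGrading {K : Type*} [Field K] {n : ℕ} (I J : Ideal (MvPolynomial (Fin n) K))
    (a : Fin n →₀ ℕ) : Submodule K (IdealQuot I J) :=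
  ((Submodule.span K {mono K a}).comap (I.subtype.restrictScalars K)).map
    ((Submodule.mkQ (Submodule.submoduleOf J I)).restrictScalars K)

/-- `sdepth_S I/J`, for monomial ideals `J ≤ I` of `S`; in particular, `sdepth ⊤ I` is
`sdepth_S S/I`. -/
def sdepth {K : Type*} [Field K] {n : ℕ} (I J : Ideal (MvPolynomial (Fin n) K)) : ℕ∞ :=
  stanleyDepth (idealQuotGrading I J)

/-! ### Depth -/

/-- `depth_S M` of an `S`-module: the largest length of an `M`-regular sequence in the graded
maximal ideal `(X_1, …, X_n)`. -/
def depth (K : Type*) [Field K] (n : ℕ) (M : Type*) [AddCommGroup M]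
    [Module (MvPolynomial (Fin n) K) M] : ℕ∞ :=
  sSup {d | ∃ rs : List (MvPolynomial (Fin n) K),
    (∀ f ∈ rs, f ∈ Ideal.span (Set.range (X : Fin n → MvPolynomial (Fin n) K))) ∧
    RingTheory.Sequence.IsRegular M rs ∧ d = (rs.length : ℕ∞)}

/-! ### Deformations and generic monomial ideals -/

/-- `ε` is a deformation of the set of monomials with exponent vectors in `G` (the values of `ε`
outside `G` play no role). -/
def IsDeformation {n : ℕ} (G : Finset (Fin n →₀ ℕ)) (ε : (Fin n →₀ ℕ) → (Fin n →₀ ℕ)) : Prop :=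
  (∀ a ∈ G, ∀ b ∈ G, ∀ j, a j > b j → a j + ε a j > b j + ε b j) ∧
  (∀ a ∈ G, ∀ j, a j = 0 → ε a j = 0)

/-- The exponent vectors `a + ε a`, `a ∈ G`, of the deformed monomials. -/
def deform {n : ℕ} (ε : (Fin n →₀ ℕ) → (Fin n →₀ ℕ)) (G : Finset (Fin n →₀ ℕ)) :
    Finset (Fin n →₀ ℕ) :=
  G.image fun a => a + ε a

/-- The exponent vectors of the minimal monomial generators of a monomial ideal: the monomials of
`I` that are minimal under divisibility. -/
def minimalGenerators {K : Type*} [Field K] {n : ℕ} (I : Ideal (MvPolynomial (Fin n) K)) :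
    Set (Fin n →₀ ℕ) :=
  {a | Minimal (fun b => mono K b ∈ I) a}

/-- `X^a` strictly divides `X^b`: it divides `X^b / X_j` for every variable `X_j` dividing
`X^b`. -/
def StrictlyDivides {n : ℕ} (a b : Fin n →₀ ℕ) : Prop :=
  ∀ j, 0 < b j → a ≤ b - Finsupp.single j 1

/-- A monomial ideal is generic if, for any two distinct minimal generators having the same
positive degree in some variable, a third minimal generator strictly divides their lcm. -/
def IsGeneric {K : Type*} [Field K] {n : ℕ} (I : Ideal (MvPolynomial (Fin n) K)) : Prop :=
  ∀ a ∈ minimalGenerators I, ∀ b ∈ minimalGenerators I, a ≠ b →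
    (∃ j, a j = b j ∧ 0 < a j) →
    ∃ c ∈ minimalGenerators I, c ≠ a ∧ c ≠ b ∧ StrictlyDivides c (a ⊔ b)

end Stanley

end

/-!
Both parts are statements about sets of exponent vectors. A Stanley decomposition of `I / J` is
the same as a partition of the exponents of the monomials in `I` outside `J` into cones `c + ℕ^Z`,
with the same sets `Z` (`IsStanleyDecomposition.hasConePartition` and
`HasConePartition.le_sdepth`).

Deformation. In each coordinate `j`, let `φ_j t` be the largest deformed exponent of those
generators whose original exponent is at most `t`. These maps are monotone, and the definition of a
deformation says precisely that `φ = (φ_1, …, φ_n)` satisfies `g + ε g ≤ φ m ↔ g ≤ m` for all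
generators `g`; hence membership in `I` and `J` is pulled back by `φ` from membership in the deformed
ideals. The preimage of a cone under `φ` is empty or a product of intervals that is unbounded in all
the free directions of the cone, and such a box is a finite union of cones with at least as many
free directions (`HasConePartition.preimage`). So Stanley depth does not drop along `φ`.

Generic ideals. Truncate exponents at a bound `D` of the generators, so that a coordinate `D` means
"arbitrarily large". Send each monomial outside `I` to the lexicographically largest element `a` of
the box `[0, D]^n` outside `I` that lies above its truncation. Each such `a` is a corner, that is,
maximal outside `I` in the box. The fibres of this assignment are boxes whose infinite sides are the
directions with `a j = D`. The reason is an exchange property (`GenericSet.exists_exchange`), the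
shellability of the set of corners: if `a + e_i` lies in `I`, genericity leaves a single minimal
generator below it, so lowering one coordinate is enough to leave `I` again. The resulting cones have
dimension at least `min_a |{j | a j = D}|` (`GenericSet.hasConePartition_compl`).

Depth. The monomial at a corner `a` has the prime annihilator `(X_j : a j < D)` in `S / I`. The depth
of a module is at most `dim S / P` for each associated prime `P` contained in `(X_1, …, X_n)`: dividing
by a regular element properly enlarges associated primes
(`exists_isAssociatedPrime_quotSMulTop`), so a regular sequence of length `r` gives a chain of
`r` proper inclusions of primes above `P`. Hence every cone above has dimension at least
`depth S / I`, with no need for the homological description of that depth.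
-/

/-! ### Regular sequences and associated primes -/

namespace Stanley

/-- A form of Nakayama's lemma at a prime `q`, proved by the determinant trick: if `s N ⊆ x N` with
`x ∈ q` and some element of `N` has its annihilator inside `q`, then `s ∈ q`. -/
theorem mem_of_forall_exists_smul_eq {R N : Type*} [CommRing R] [AddCommGroup N] [Module R N]
    [Module.Finite R N] {q : Ideal R} [hq : q.IsPrime] {s x : R} (hx : x ∈ q)
    (h : ∀ m : N, ∃ m', s • m = x • m') {z : N} (hz : ∀ r : R, r • z = 0 → r ∈ q) : s ∈ q := by
  have hrange : LinearMap.range (Module.toModuleEnd R N s) ≤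
      Ideal.span {x} • (⊤ : Submodule R N) := by
    rintro _ ⟨m, rfl⟩
    obtain ⟨m', hm'⟩ := h m
    simp only [Module.toModuleEnd_apply, DistribSMul.toLinearMap_apply, hm']
    exact Submodule.smul_mem_smul (Ideal.mem_span_singleton_self x) trivial
  obtain ⟨f, hf, -, hcoeff, hfs⟩ :=
    LinearMap.exists_monic_and_natDegree_eq_and_coeff_mem_pow_and_aeval_eq_zero
      R (Module.toModuleEnd R N s) (Ideal.span {x}) hrange
  have hev : f.eval s ∈ q := by
    refine hz _ ?_
    have h1 : Module.toModuleEnd R N s = algebraMap R (Module.End R N) s := rfl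
    rw [h1, Polynomial.aeval_algebraMap_apply] at hfs
    simpa using congrArg (fun φ : Module.End R N => φ z) hfs
  rw [Polynomial.eval_eq_sum_range, Finset.sum_range_succ, hf.coeff_natDegree, one_mul] at hev
  refine hq.mem_of_pow_mem f.natDegree ((Ideal.add_mem_iff_right _ ?_).1 hev)
  refine Ideal.sum_mem _ fun k hk => Ideal.mul_mem_right _ _ ?_
  have hk : f.natDegree - k ≠ 0 := by have := Finset.mem_range.1 hk; omega
  exact (Ideal.pow_le_self hk).trans ((Ideal.span_singleton_le_iff_mem _).2 hx) (hcoeff k)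

/-- Dividing by a nonzerodivisor `x` strictly enlarges associated primes: inside any prime `q`
that contains `x` and the associated prime `p` of `M` there is an associated prime of `M / xM` that
properly contains `p`. -/
theorem exists_isAssociatedPrime_quotSMulTop {R M : Type*} [CommRing R] [IsNoetherianRing R]
    [AddCommGroup M] [Module R M] [Module.Finite R M] {x : R} (hx : IsSMulRegular M x)
    {p q : Ideal R} [q.IsPrime] (hp : IsAssociatedPrime p M) (hpq : p ≤ q) (hxq : x ∈ q) :
    ∃ p' : Ideal R, IsAssociatedPrime p' (QuotSMulTop x M) ∧ p < p' ∧ p' ≤ q := by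
  obtain ⟨hpp, z, hz⟩ := (isAssociatedPrime_iff (M := M)).1 hp
  have hmemp : ∀ r, r ∈ p ↔ r • z = 0 := fun r => by
    rw [hz, Submodule.mem_colon_singleton, Submodule.mem_bot]
  have hxp : x ∉ p := fun h => by
    have hz0 : z = 0 := hx (by simpa using (hmemp x).1 h)
    exact hpp.ne_top ((Ideal.eq_top_iff_one p).2 ((hmemp 1).2 (by simp [hz0])))
  obtain ⟨p', hp', hp'q⟩ := Ideal.exists_minimalPrimes_le
    (I := p ⊔ Ideal.span {x}) (J := q)
    (sup_le hpq ((Ideal.span_singleton_le_iff_mem _).2 hxq))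
  have hpp' : p ≤ p' := le_sup_left.trans hp'.1.2
  have hxp' : x ∈ p' :=
    hp'.1.2 (Ideal.mem_sup_right (Ideal.mem_span_singleton_self x))
  have := hp'.1.1
  refine ⟨p', ?_, lt_of_le_of_ne hpp' fun h => hxp (h ▸ hxp'), hp'q⟩
  -- `N` consists of the elements killed by `p`; its image in `M / xM` has `p'` as a minimal prime
  -- of its annihilator, since that annihilator lies between `p + (x)` and `p'`.
  let N : Submodule R M :=
    { carrier := {m | ∀ r ∈ p, r • m = 0}
      add_mem' := fun {a b} ha hb r hr => by rw [smul_add, ha r hr, hb r hr, add_zero]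
      zero_mem' := fun r _ => smul_zero r
      smul_mem' := fun c m hm r hr => by rw [smul_comm, hm r hr, smul_zero] }
  have hzN : z ∈ N := fun r hr => (hmemp r).1 hr
  let π : M →ₗ[R] QuotSMulTop x M := Submodule.mkQ _
  have hπ : ∀ m, π m = 0 ↔ ∃ m', x • m' = m := fun m => by
    refine (Submodule.Quotient.mk_eq_zero _).trans ?_
    rw [Submodule.mem_smul_pointwise_iff_exists]
    simp
  let N' := N.map π
  have hmem : ∀ s, s ∈ Module.annihilator R N' ↔ ∀ m ∈ N, π (s • m) = 0 := fun s => by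
    rw [Module.mem_annihilator]
    constructor
    · intro h m hm
      rw [map_smul]
      exact congrArg Subtype.val (h ⟨π m, m, hm, rfl⟩)
    · rintro h ⟨_, m, hm, rfl⟩
      ext
      exact (map_smul π s m).symm.trans (h m hm)
  have hle : p ⊔ Ideal.span {x} ≤ Module.annihilator R N' := by
    refine sup_le (fun r hr => ?_) ((Ideal.span_singleton_le_iff_mem _).2 ?_)
    · exact (hmem r).2 fun m hm => by rw [hm r hr, map_zero]
    · exact (hmem x).2 fun m _ => (hπ _).2 ⟨m, rfl⟩
  have hann : Module.annihilator R N' ≤ p' := by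
    intro s hs
    -- `x` is regular on `M`, so `s N ⊆ xM ∩ N = xN`.
    refine mem_of_forall_exists_smul_eq (N := N) (z := ⟨z, hzN⟩) hxp' (fun m => ?_)
      fun r hr => hpp' ((hmemp r).2 (congrArg Subtype.val hr))
    obtain ⟨m', hm'⟩ := (hπ _).1 ((hmem s).1 hs m m.2)
    refine ⟨⟨m', fun r hr => hx ?_⟩, Subtype.ext hm'.symm⟩
    change x • r • m' = x • 0
    rw [smul_comm, hm', smul_comm, m.2 r hr, smul_zero, smul_zero]
  have hmin : p' ∈ (Module.annihilator R N').minimalPrimes :=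
    ⟨⟨hp'.1.1, hann⟩, fun r hr hrp => hp'.2 ⟨hr.1, hle.trans hr.2⟩ hrp⟩
  exact IsAssociatedPrime.map_of_injective N'.subtype
    (Module.associatedPrimes.minimalPrimes_annihilator_subset_associatedPrimes R N' hmin)
    N'.injective_subtype

/-- A weakly regular sequence of length `r` inside a prime `q` yields a chain of `r` proper
inclusions of primes above each associated prime below `q`. -/
theorem length_le_coheight_of_isWeaklyRegular {R M : Type*} [CommRing R] [IsNoetherianRing R]
    [AddCommGroup M] [Module R M] [Module.Finite R M] {rs : List R}
    (hrs : RingTheory.Sequence.IsWeaklyRegular M rs) {p q : PrimeSpectrum R}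
    (hp : IsAssociatedPrime p.asIdeal M) (hpq : p ≤ q) (hq : ∀ r ∈ rs, r ∈ q.asIdeal) :
    (rs.length : ℕ∞) ≤ Order.coheight p := by
  induction rs generalizing M p with
  | nil => simp
  | cons x rs ih =>
    rw [RingTheory.Sequence.isWeaklyRegular_cons_iff] at hrs
    obtain ⟨p', hp', hlt, hle⟩ := exists_isAssociatedPrime_quotSMulTop hrs.1 hp
      (q := q.asIdeal) hpq (hq x (by simp))
    have := ih hrs.2 (p := ⟨p', hp'.isPrime⟩) hp' hle fun r hr => hq r (by simp [hr])
    calc ((x :: rs).length : ℕ∞) = rs.length + 1 := by simp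
      _ ≤ Order.coheight (⟨p', hp'.isPrime⟩ : PrimeSpectrum R) + 1 := by gcongr
      _ ≤ Order.coheight p := Order.coheight_add_one_le hlt

open MvPolynomial

/-! ### Monomial ideals and a bound for the depth -/

/-- The coheight of a prime is the Krull dimension of the quotient ring. -/
theorem coheight_eq_ringKrullDim_quotient {R : Type*} [CommRing R] (p : PrimeSpectrum R) :
    (Order.coheight p : WithBot ℕ∞) = ringKrullDim (R ⧸ p.asIdeal) := by
  rw [ringKrullDim_quotient, Order.coheight_eq_krullDim_Ici]
  rfl

/-- An ideal of `S` is monomial if it contains a polynomial exactly when it contains all the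
monomials of its support. -/
def IsMonomialIdeal {K : Type*} [Field K] {n : ℕ} (I : Ideal (MvPolynomial (Fin n) K)) : Prop :=
  ∀ f, f ∈ I ↔ ∀ m ∈ f.support, mono K m ∈ I

section MonomialIdeals

variable {K : Type*} [Field K] {n : ℕ}

theorem mono_mem_monomialIdeal {G : Finset (Fin n →₀ ℕ)} {m : Fin n →₀ ℕ} :
    mono K m ∈ monomialIdeal K G ↔ ∃ g ∈ G, g ≤ m := by
  refine mem_ideal_span_monomial_image.trans ?_
  simp [mono]

theorem isMonomialIdeal_monomialIdeal (G : Finset (Fin n →₀ ℕ)) :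
    IsMonomialIdeal (monomialIdeal K G) := fun f => by
  simp_rw [mono_mem_monomialIdeal]
  exact mem_ideal_span_monomial_image

theorem isMonomialIdeal_top : IsMonomialIdeal (⊤ : Ideal (MvPolynomial (Fin n) K)) := fun f => by
  simp

theorem mono_mem_of_le {I : Ideal (MvPolynomial (Fin n) K)} {a b : Fin n →₀ ℕ} (hab : a ≤ b)
    (ha : mono K a ∈ I) : mono K b ∈ I := by
  have : mono K b = mono K (b - a) * mono K a := by
    simp [mono, monomial_mul, tsub_add_cancel_of_le hab]
  exact this ▸ I.mul_mem_left _ ha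

theorem IsMonomialIdeal.mul_mono_mem {I : Ideal (MvPolynomial (Fin n) K)}
    (hI : IsMonomialIdeal I) (f : MvPolynomial (Fin n) K) (a : Fin n →₀ ℕ) :
    f * mono K a ∈ I ↔ ∀ m ∈ f.support, mono K (m + a) ∈ I := by
  rw [hI]
  constructor
  · intro h m hm
    refine h _ ?_
    rw [mem_support_iff, mono, coeff_mul_monomial, mul_one]
    exact mem_support_iff.1 hm
  · intro h m hm
    rw [mem_support_iff, mono, coeff_mul_monomial', mul_one] at hm
    split_ifs at hm with hle
    · have := h _ (mem_support_iff.2 hm)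
      rwa [tsub_add_cancel_of_le hle] at this
    · exact absurd rfl hm

/-- The kernel of the substitution that kills the variables outside `Z` is the ideal generated by
these variables. -/
theorem mem_ker_killCompl (Z : Finset (Fin n)) (f : MvPolynomial (Fin n) K) :
    f ∈ RingHom.ker (killCompl (R := K) (Subtype.val_injective (p := (· ∈ Z)))) ↔
      ∀ m ∈ f.support, ∃ j ∉ Z, m j ≠ 0 := by
  set κ := killCompl (R := K) (Subtype.val_injective (p := (· ∈ Z)))
  refine Iff.trans ?_ (mem_ideal_span_X_image (s := {j | j ∉ Z}))
  set P : Ideal (MvPolynomial (Fin n) K) := Ideal.span (X '' {j | j ∉ Z})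
  have hX : ∀ j ∉ Z, κ (X j) = 0 := fun j hj => by
    simp [κ, killCompl, hj]
  constructor
  · intro hf
    -- Modulo the variables outside `Z`, every polynomial agrees with its image under `killCompl`.
    have hcomp : ((Ideal.Quotient.mkₐ K P).comp (rename Subtype.val)).comp κ =
        Ideal.Quotient.mkₐ K P := by
      ext j
      by_cases hj : j ∈ Z
      · have : κ (X j) = X ⟨j, hj⟩ := by
          have := killCompl_rename_app (R := K) (Subtype.val_injective (p := (· ∈ Z)))
            (X ⟨j, hj⟩)
          simpa using this
        simp [this]
      · have h0 : Ideal.Quotient.mk P (X j) = 0 :=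
          Ideal.Quotient.eq_zero_iff_mem.2 (Ideal.subset_span ⟨j, hj, rfl⟩)
        simp [hX j hj, h0]
    have := AlgHom.congr_fun hcomp f
    rw [AlgHom.comp_apply, RingHom.mem_ker.1 hf, map_zero] at this
    exact Ideal.Quotient.eq_zero_iff_mem.1 this.symm
  · intro hf
    have : P ≤ RingHom.ker κ := Ideal.span_le.2 (by rintro _ ⟨j, hj, rfl⟩; exact hX j hj)
    exact this hf

/-- If `X^a` has annihilator `(X_j : j ∉ Z)` in `S / I`, then `depth S / I` is at most `|Z|`, the
dimension of `S / (X_j : j ∉ Z)`. -/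
theorem depth_quotient_le_card {I : Ideal (MvPolynomial (Fin n) K)} (hI : IsMonomialIdeal I)
    {a : Fin n →₀ ℕ} {Z : Finset (Fin n)}
    (hout : ∀ j ∉ Z, mono K (a + Finsupp.single j 1) ∈ I)
    (hin : ∀ m : Fin n →₀ ℕ, (∀ j ∉ Z, m j = 0) → mono K (a + m) ∉ I) :
    depth K n (MvPolynomial (Fin n) K ⧸ I) ≤ Z.card := by
  set κ := killCompl (R := K) (Subtype.val_injective (p := (· ∈ Z)))
  have hsurj : Function.Surjective κ := fun f => ⟨_, killCompl_rename_app _ f⟩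
  let p : PrimeSpectrum (MvPolynomial (Fin n) K) := ⟨RingHom.ker κ, RingHom.ker_isPrime κ⟩
  have hp : IsAssociatedPrime p.asIdeal (MvPolynomial (Fin n) K ⧸ I) := by
    refine (isAssociatedPrime_iff (M := MvPolynomial (Fin n) K ⧸ I)).2
      ⟨p.isPrime, Ideal.Quotient.mk I (mono K a), ?_⟩
    ext f
    have h1 : f • Ideal.Quotient.mk I (mono K a) = Ideal.Quotient.mk I (f * mono K a) := rfl
    rw [Submodule.mem_colon_singleton, Submodule.mem_bot, h1, Ideal.Quotient.eq_zero_iff_mem,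
      hI.mul_mono_mem]
    refine (mem_ker_killCompl Z f).trans (forall₂_congr fun m _ => ?_)
    constructor
    · rintro ⟨j, hj, hmj⟩
      refine mono_mem_of_le ?_ (hout j hj)
      rw [add_comm]
      gcongr
      rw [Finsupp.single_le_iff]
      omega
    · intro h
      by_contra! hm
      exact hin m hm (add_comm m a ▸ h)
  let q : PrimeSpectrum (MvPolynomial (Fin n) K) :=
    ⟨RingHom.ker (constantCoeff (R := K) (σ := Fin n)), RingHom.ker_isPrime _⟩
  have hpq : p ≤ q := by
    intro f hf
    change constantCoeff f = 0
    by_contra h0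
    obtain ⟨j, -, hj⟩ := (mem_ker_killCompl Z f).1 hf 0 (mem_support_iff.2 h0)
    simp at hj
  have hq : Ideal.span (Set.range (X : Fin n → MvPolynomial (Fin n) K)) ≤ q.asIdeal := by
    rw [Ideal.span_le]
    rintro _ ⟨j, rfl⟩
    simp [q]
  have hdim : (Order.coheight p : WithBot ℕ∞) = Z.card := by
    have he : ringKrullDim (MvPolynomial (Fin n) K ⧸ p.asIdeal) =
        ringKrullDim (MvPolynomial Z K) :=
      ringKrullDim_eq_of_ringEquiv
        (RingHom.quotientKerEquivOfSurjective (f := κ.toRingHom) hsurj)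
    rw [coheight_eq_ringKrullDim_quotient, he, MvPolynomial.ringKrullDim_of_isNoetherianRing]
    simp
  refine sSup_le ?_
  rintro d ⟨rs, hrs, hreg, rfl⟩
  have := length_le_coheight_of_isWeaklyRegular hreg.toIsWeaklyRegular hp hpq
    fun r hr => hq (hrs r hr)
  refine this.trans (le_of_eq ?_)
  exact_mod_cast hdim

end MonomialIdeals

end Stanley

/-! ### Cone partitions of sets of exponent vectors -/

namespace Stanley

variable {n : ℕ}

/-- The exponent vectors of the monomials in `X^c K[Z]`. -/
def cone (c : Fin n →₀ ℕ) (Z : Finset (Fin n)) : Set (Fin n →₀ ℕ) :=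
  {m | c ≤ m ∧ ∀ j ∉ Z, m j = c j}

theorem self_mem_cone (c : Fin n →₀ ℕ) (Z : Finset (Fin n)) : c ∈ cone c Z :=
  ⟨le_rfl, fun _ _ => rfl⟩

/-- `A` is a disjoint union of finitely many cones of dimension at least `d`. -/
def HasConePartition (A : Set (Fin n →₀ ℕ)) (d : ℕ∞) : Prop :=
  ∃ P : Finset ((Fin n →₀ ℕ) × Finset (Fin n)),
    (∀ p ∈ P, d ≤ p.2.card ∧ cone p.1 p.2 ⊆ A) ∧ ∀ m ∈ A, ∃! p, p ∈ P ∧ m ∈ cone p.1 p.2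

theorem hasConePartition_empty (d : ℕ∞) : HasConePartition (∅ : Set (Fin n →₀ ℕ)) d :=
  ⟨∅, by simp, by simp⟩

theorem HasConePartition.of_pieces {A : Set (Fin n →₀ ℕ)} {d : ℕ∞} {ι : Type*} (s : Finset ι)
    {B : ι → Set (Fin n →₀ ℕ)} (hB : ∀ i ∈ s, HasConePartition (B i) d)
    (hsub : ∀ i ∈ s, B i ⊆ A) (hA : ∀ m ∈ A, ∃! i, i ∈ s ∧ m ∈ B i) : HasConePartition A d := by
  classical
  choose! P hP hP' using hB
  refine ⟨s.biUnion P, fun p hp => ?_, fun m hm => ?_⟩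
  · obtain ⟨i, hi, hp⟩ := Finset.mem_biUnion.1 hp
    exact ⟨(hP i hi p hp).1, (hP i hi p hp).2.trans (hsub i hi)⟩
  · obtain ⟨i, ⟨hi, hmi⟩, huniq⟩ := hA m hm
    obtain ⟨p, ⟨hp, hmp⟩, hpuniq⟩ := hP' i hi m hmi
    refine ⟨p, ⟨Finset.mem_biUnion.2 ⟨i, hi, hp⟩, hmp⟩, ?_⟩
    rintro p' ⟨hp', hmp'⟩
    obtain ⟨i', hi', hp'⟩ := Finset.mem_biUnion.1 hp'
    obtain rfl := huniq i' ⟨hi', (hP i' hi' p' hp').2 hmp'⟩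
    exact hpuniq p' ⟨hp', hmp'⟩

/-- A product of intervals of `ℕ` is partitioned by the cones spanned by its infinite sides: such a
cone starts at the least element of every infinite side and at an arbitrary element of every finite
one. -/
theorem hasConePartition_box {T : Fin n → Set ℕ} (hne : ∀ j, (T j).Nonempty)
    (hord : ∀ j, (T j).OrdConnected) {d : ℕ∞} (Z : Finset (Fin n)) (hd : d ≤ Z.card)
    (hZ : ∀ j ∈ Z, (T j).Infinite) : HasConePartition {m | ∀ j, m j ∈ T j} d := by
  classical
  let W : Finset (Fin n) := {j | (T j).Infinite}
  have hW : ∀ j, j ∈ W ↔ (T j).Infinite := by simp [W]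
  let F : Fin n → Finset ℕ := fun j =>
    if h : (T j).Finite then h.toFinset else {sInf (T j)}
  have hFW : ∀ j ∈ W, F j = {sInf (T j)} := fun j hj => dif_neg ((hW j).1 hj)
  have hFnW : ∀ j ∉ W, ∀ t, t ∈ F j ↔ t ∈ T j := fun j hj t => by
    have h : (T j).Finite := Set.not_infinite.1 fun h => hj ((hW j).2 h)
    simp [F, h]
  let e := (Finsupp.equivFunOnFinite (α := Fin n) (M := ℕ)).symm
  refine ⟨(Fintype.piFinset F).image fun c => (e c, W), fun p hp => ?_, fun m hm => ?_⟩
  · obtain ⟨c, hc, rfl⟩ := Finset.mem_image.1 hp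
    rw [Fintype.mem_piFinset] at hc
    refine ⟨hd.trans ?_, fun m hm j => ?_⟩
    · exact_mod_cast Finset.card_le_card fun j hj => (hW j).2 (hZ j hj)
    · by_cases hj : j ∈ W
      · have h1 : c j = sInf (T j) := by simpa [hFW j hj] using hc j
        obtain ⟨t, ht, hlt⟩ := ((hW j).1 hj).exists_gt (m j)
        refine (hord j).out (Nat.sInf_mem (hne j)) ht ⟨?_, hlt.le⟩
        rw [← h1]
        exact hm.1 j
      · have h1 : m j = c j := hm.2 j hj
        rw [h1]
        exact (hFnW j hj _).1 (hc j)
  · refine ⟨(e fun j => if j ∈ W then sInf (T j) else m j, W), ⟨?_, ?_, ?_⟩, ?_⟩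
    · refine Finset.mem_image.2 ⟨_, Fintype.mem_piFinset.2 fun j => ?_, rfl⟩
      by_cases hj : j ∈ W
      · simp [hj, hFW j hj]
      · simpa [hj, hFnW j hj] using hm j
    · intro j
      by_cases hj : j ∈ W
      · simpa [e, hj] using Nat.sInf_le (hm j)
      · simp [e, hj]
    · intro j hj
      simp [e, show j ∉ W from hj]
    · rintro _ ⟨hp, hmp⟩
      obtain ⟨c, hc, rfl⟩ := Finset.mem_image.1 hp
      rw [Fintype.mem_piFinset] at hc
      congr 2
      funext j
      by_cases hj : j ∈ W
      · simpa [hj, hFW j hj] using hc j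
      · simpa [e, hj] using (hmp.2 j hj).symm

/-- Cone partitions pull back along products of monotone maps `ℕ → ℕ` without loss of dimension:
the preimage of a cone is empty or a box in which the free directions stay infinite. -/
theorem HasConePartition.preimage {A : Set (Fin n →₀ ℕ)} {d : ℕ∞} (hA : HasConePartition A d)
    {φ : (Fin n →₀ ℕ) → (Fin n →₀ ℕ)} {ψ : Fin n → ℕ → ℕ} (hψ : ∀ j, Monotone (ψ j))
    (hφ : ∀ m j, φ m j = ψ j (m j)) : HasConePartition (φ ⁻¹' A) d := by
  obtain ⟨P, hP, hPA⟩ := hA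
  refine HasConePartition.of_pieces P (B := fun p => φ ⁻¹' cone p.1 p.2) (fun p hp => ?_)
    (fun p hp => Set.preimage_mono (hP p hp).2) fun m hm => hPA _ hm
  let T : Fin n → Set ℕ := fun j => {t | p.1 j ≤ ψ j t ∧ (j ∉ p.2 → ψ j t = p.1 j)}
  have hT : φ ⁻¹' cone p.1 p.2 = {m | ∀ j, m j ∈ T j} := by
    ext m
    simp only [Set.mem_preimage, cone, Set.mem_ofPred_eq, Finsupp.le_def, hφ, T, forall_and]
  rw [hT]
  by_cases hne : ∀ j, (T j).Nonempty
  · refine hasConePartition_box hne (fun j => ⟨fun s hs t ht u hu => ⟨?_, fun hj => ?_⟩⟩) p.2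
      (hP p hp).1 fun j hj => ?_
    · exact hs.1.trans (hψ j hu.1)
    · exact le_antisymm ((hψ j hu.2).trans_eq (ht.2 hj)) (hs.1.trans (hψ j hu.1))
    · obtain ⟨t, ht⟩ := hne j
      exact (Set.Ici_infinite t).mono fun u hu =>
        ⟨ht.1.trans (hψ j hu), fun h => absurd hj h⟩
  · push Not at hne
    obtain ⟨j, hj⟩ := hne
    convert! hasConePartition_empty d
    exact Set.eq_empty_of_forall_notMem fun m hm => by simpa [hj] using hm j

/-! ### The lexicographic partition outside a generic upper set -/

/-- `a` is maximal among the exponent vectors outside `U` in the box `[0, D]^n`. -/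
def IsCorner (U : Set (Fin n →₀ ℕ)) (D : ℕ) (a : Fin n →₀ ℕ) : Prop :=
  a ∉ U ∧ (∀ j, a j ≤ D) ∧ ∀ j, a j < D → a + Finsupp.single j 1 ∈ U

/-- Two different elements of `U` that are minimal and have a positive coordinate in common
strictly dominate, in that coordinate, an element of `U` below their supremum. -/
def GenericSet (U : Set (Fin n →₀ ℕ)) : Prop :=
  ∀ a b, Minimal (· ∈ U) a → Minimal (· ∈ U) b → a ≠ b → ∀ j, a j = b j → 0 < a j →
    ∃ c ∈ U, c ≤ a ⊔ b ∧ c j < (a ⊔ b) j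

/-- If `a ∉ U` but `a + e_i ∈ U`, only one minimal element of a generic `U` lies below `a + e_i`:
two of them would share the positive coordinate `a i + 1`, and genericity would put `a` into `U`. -/
theorem GenericSet.eq_of_le_add_single {U : Set (Fin n →₀ ℕ)} (hU : GenericSet U)
    (hup : IsUpperSet U) {a : Fin n →₀ ℕ} (ha : a ∉ U) {i : Fin n} {b c : Fin n →₀ ℕ}
    (hb : Minimal (· ∈ U) b) (hc : Minimal (· ∈ U) c) (hba : b ≤ a + Finsupp.single i 1)
    (hca : c ≤ a + Finsupp.single i 1) : b = c := by
  have key : ∀ m ≤ a + Finsupp.single i 1, m ∈ U → a i < m i := by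
    intro m hm hmU
    by_contra! h
    refine ha (hup (fun j => ?_) hmU)
    by_cases hj : j = i
    · exact hj ▸ h
    · simpa [Finsupp.single_apply, Ne.symm hj] using hm j
  have hbi := key b hba hb.1
  have hci := key c hca hc.1
  have hbi' := hba i
  have hci' := hca i
  simp only [Finsupp.add_apply, Finsupp.single_eq_same] at hbi' hci'
  by_contra hbc
  obtain ⟨m, hmU, hm, hmi⟩ := hU b c hb hc hbc i (by omega) (by omega)
  have h1 := key m (hm.trans (sup_le hba hca)) hmU
  simp only [Finsupp.sup_apply] at hmi
  have : max (b i) (c i) ≤ a i + 1 := max_le hbi' hci'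
  omega

/-- The exchange property behind the lexicographic partition: below a corner `a` and a
lexicographically larger `a'` outside `U`, there is `a''` outside `U`, still lexicographically
larger than `a`, that fails to dominate `a` in a single coordinate `j` only, where it is at least
as large as `min a a'`. -/
theorem GenericSet.exists_exchange {U : Set (Fin n →₀ ℕ)} (hU : GenericSet U) (hup : IsUpperSet U)
    {D : ℕ} {a a' : Fin n →₀ ℕ} (ha : IsCorner U D a) (ha' : a' ∉ U) (ha'D : ∀ j, a' j ≤ D)
    (hlt : toLex a < toLex a') :
    ∃ a'' : Fin n →₀ ℕ, ∃ j, a'' ∉ U ∧ (∀ i, a'' i ≤ D) ∧ toLex a < toLex a'' ∧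
      (∀ i ≠ j, a i ≤ a'' i) ∧ a'' j < a j ∧ min (a j) (a' j) ≤ a'' j := by
  obtain ⟨i, heq, hi⟩ := Finsupp.Lex.lt_iff.1 hlt
  simp only [ofLex_toLex] at heq hi
  have hb : a + Finsupp.single i 1 ∈ U := ha.2.2 i (hi.trans_le (ha'D i))
  obtain ⟨g, hg, hgmin⟩ := exists_minimal_le_of_wellFoundedLT (· ∈ U) _ hb
  obtain ⟨j, hj⟩ : ∃ j, a' j < g j := by
    by_contra! h
    exact ha' (hup h hgmin.1)
  have hgi := hg i
  simp only [Finsupp.add_apply, Finsupp.single_eq_same] at hgi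
  have hji : j ≠ i := by rintro rfl; omega
  have hgj : g j ≤ a j := by simpa [Finsupp.single_apply, hji.symm] using hg j
  have hij : i < j := by
    rcases lt_trichotomy i j with h | h | h
    · exact h
    · exact absurd h.symm hji
    · have := heq j h
      omega
  -- As `g` is the only minimal element of `U` below `a + e_i`, lowering the coordinate `j` of
  -- `a + e_i` just below `g j` is enough to leave `U`.
  let a'' : Fin n →₀ ℕ := (a + Finsupp.single i 1).update j (g j - 1)
  have hj'' : a'' j = g j - 1 := by simp [a'']
  have hi'' : a'' i = a i + 1 := by simp [a'', Finsupp.update_apply, hji.symm]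
  have hk'' : ∀ k, k ≠ j → k ≠ i → a'' k = a k := fun k hkj hki => by
    simp [a'', Finsupp.update_apply, hkj, hki.symm]
  have hle : a'' ≤ a + Finsupp.single i 1 := fun k => by
    by_cases hkj : k = j
    · subst hkj
      rw [hj'']
      exact (Nat.sub_le _ _).trans (hg k)
    · simp [a'', Finsupp.update_apply, hkj]
  refine ⟨a'', j, fun hmem => ?_, fun k => ?_, ?_, fun k hk => ?_, by omega, by omega⟩
  · obtain ⟨g', hg', hg'min⟩ := exists_minimal_le_of_wellFoundedLT (· ∈ U) _ hmem
    obtain rfl := hU.eq_of_le_add_single hup ha.1 hgmin hg'min hg (hg'.trans hle)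
    have := hg' j
    omega
  · by_cases hkj : k = j
    · subst hkj
      have := ha.2.1 k
      omega
    · by_cases hki : k = i
      · subst hki
        have := ha'D k
        omega
      · rw [hk'' k hkj hki]
        exact ha.2.1 k
  · refine Finsupp.Lex.lt_iff.2 ⟨i, fun k hk => ?_, ?_⟩
    · simp only [ofLex_toLex]
      rw [hk'' k (hk.trans hij).ne hk.ne]
    · simp only [ofLex_toLex]
      omega
  · by_cases hki : k = i
    · subst hki
      omega
    · rw [hk'' k hk hki]

/-- The complement of a generic upper set that is determined by its trace on `[0, D]^n` is
partitioned by cones with as many free directions as its corners have coordinates `D`. -/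
theorem GenericSet.hasConePartition_compl {U : Set (Fin n →₀ ℕ)} (hU : GenericSet U)
    (hup : IsUpperSet U) {D : ℕ}
    (hD : ∀ b ∈ U, ∃ b' ∈ U, b' ≤ b ∧ ∀ j, b' j ≤ D) {d : ℕ∞}
    (hd : ∀ a, IsCorner U D a → d ≤ (Finset.univ.filter fun j => a j = D).card) :
    HasConePartition Uᶜ d := by
  classical
  let e := (Finsupp.equivFunOnFinite (α := Fin n) (M := ℕ)).symm
  let C : Finset (Fin n →₀ ℕ) := (Finset.Iic (e fun _ => D)).filter (· ∉ U)
  have hC : ∀ a, a ∈ C ↔ a ∉ U ∧ ∀ j, a j ≤ D := fun a => by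
    simp [C, Finsupp.le_def, e, and_comm]
  let E := C.filter (IsCorner U D)
  have hE : ∀ a, a ∈ E ↔ IsCorner U D a := fun a => by
    simp only [E, Finset.mem_filter, hC, IsCorner]
    tauto
  -- `b` is assigned to the lexicographically largest `a ∈ C` above the truncation of `b`.
  let above : (Fin n →₀ ℕ) → Finset (Fin n →₀ ℕ) := fun b =>
    C.filter fun a => ∀ j, min (b j) D ≤ a j
  let B : (Fin n →₀ ℕ) → Set (Fin n →₀ ℕ) := fun a =>
    {b | a ∈ above b ∧ ∀ a' ∈ above b, toLex a' ≤ toLex a}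
  have habove : ∀ a b, a ∈ above b ↔ a ∈ C ∧ ∀ j, min (b j) D ≤ a j := fun a b => by
    simp [above]
  have hBsub : ∀ a, B a ⊆ Uᶜ := by
    intro a b hb hbU
    obtain ⟨b', hb'U, hb'b, hb'D⟩ := hD b hbU
    obtain ⟨haC, hab⟩ := (habove a b).1 hb.1
    refine ((hC a).1 haC).1 (hup (fun j => ?_) hb'U)
    have := hb'b j
    have := hb'D j
    have := hab j
    omega
  have hcorner : ∀ a b, b ∈ B a → IsCorner U D a := by
    rintro a b ⟨hab, hmax⟩
    obtain ⟨haC, hab⟩ := (habove a b).1 hab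
    obtain ⟨haU, haD⟩ := (hC a).1 haC
    refine ⟨haU, haD, fun j hj => ?_⟩
    by_contra hjU
    have hle : a ≤ a + Finsupp.single j 1 := le_self_add
    have h1 : a + Finsupp.single j 1 ∈ above b := by
      refine (habove _ _).2 ⟨(hC _).2 ⟨hjU, fun k => ?_⟩, fun k => (hab k).trans (hle k)⟩
      have := haD k
      by_cases hk : k = j
      · subst hk
        simpa using hj
      · simpa [Finsupp.single_apply, Ne.symm hk] using this
    refine absurd (hmax _ h1) (not_le.2 (Finsupp.Lex.lt_iff.2 ⟨j, fun k hk => ?_, ?_⟩))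
    · simp [hk.ne']
    · simp
  refine HasConePartition.of_pieces E (B := B) (fun a haE => ?_) (fun a _ => hBsub a)
    fun b hb => ?_
  · have ha := (hE a).1 haE
    -- The lower bound of the box in direction `j` comes from the competitors of `a` that fail to
    -- dominate `a` in direction `j` only.
    let lo : Fin n → ℕ := fun j =>
      (C.filter fun a' => toLex a < toLex a' ∧ (∀ i ≠ j, a i ≤ a' i) ∧ a' j < a j).sup
        fun a' => a' j + 1
    have hlo : ∀ j t, lo j ≤ t ↔ ∀ a' ∈ C, toLex a < toLex a' → (∀ i ≠ j, a i ≤ a' i) →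
        a' j < a j → a' j < t := fun j t => by
      simp only [lo, Finset.sup_le_iff, Finset.mem_filter, and_imp, Nat.succ_le_iff]
    let T : Fin n → Set ℕ := fun j => {t | lo j ≤ t ∧ (a j < D → t ≤ a j)}
    have hT : B a = {b | ∀ j, b j ∈ T j} := by
      ext b
      constructor
      · rintro ⟨hab, hmax⟩ j
        obtain ⟨haC, hab⟩ := (habove a b).1 hab
        refine ⟨(hlo _ _).2 fun a' ha' hlt hle hj => ?_, fun hj => ?_⟩
        · by_contra! hbj
          refine absurd (hmax a' ((habove _ _).2 ⟨ha', fun i => ?_⟩)) (not_le.2 hlt)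
          by_cases hi : i = j
          · subst hi
            exact (min_le_left _ _).trans hbj
          · exact (hab i).trans (hle i hi)
        · have := hab j
          omega
      · intro hb
        refine ⟨(habove _ _).2 ⟨(hC a).2 ⟨ha.1, ha.2.1⟩, fun j => ?_⟩, fun a' ha' => ?_⟩
        · have := (hb j).2
          have := ha.2.1 j
          omega
        · by_contra! hlt
          obtain ⟨ha'C, ha'b⟩ := (habove _ _).1 ha'
          obtain ⟨ha'U, ha'D⟩ := (hC _).1 ha'C
          obtain ⟨a'', j, hU'', hD'', hlt'', hle'', hj'', hmin⟩ :=
            hU.exists_exchange hup ha ha'U ha'D hlt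
          have h1 := (hlo j _).1 (hb j).1 a'' ((hC _).2 ⟨hU'', hD''⟩) hlt'' hle'' hj''
          have h2 := ha'b j
          have h3 := (hb j).2
          have h4 := ha.2.1 j
          omega
    rw [hT]
    refine hasConePartition_box (T := T)
      (fun j => ⟨a j, (hlo _ _).2 fun _ _ _ _ h => h, fun _ => le_rfl⟩)
      (fun j => ⟨fun s hs t ht u hu => ⟨hs.1.trans hu.1, fun h => hu.2.trans (ht.2 h)⟩⟩) _
      (hd a ha) fun j hj => ?_
    have hj : a j = D := by simpa using hj
    exact (Set.Ici_infinite (lo j)).mono fun t ht => ⟨ht, fun h => absurd hj h.ne⟩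
  · have hne : (above b).Nonempty := by
      refine ⟨e fun j => min (b j) D, (habove _ _).2 ⟨(hC _).2 ⟨fun h => hb ?_, ?_⟩, ?_⟩⟩
      · exact hup (fun j => by simp [e]) h
      · simp [e]
      · simp [e]
    obtain ⟨a, ha, hmax⟩ := Finset.exists_max_image (above b) toLex hne
    have hab : b ∈ B a := ⟨ha, hmax⟩
    refine ⟨a, ⟨(hE a).2 (hcorner a b hab), hab⟩, ?_⟩
    rintro a' ⟨-, ha', hmax'⟩
    exact toLex.injective (le_antisymm (hmax a' ha') (hmax' a ha))

end Stanley

/-! ### Stanley decompositions and cone partitions -/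

namespace Stanley

open MvPolynomial

section Translation

variable {K : Type*} [Field K] {n : ℕ} {I J : Ideal (MvPolynomial (Fin n) K)}

theorem mem_stanleySpace {M : Type*} [AddCommGroup M] [Module K M]
    [Module (MvPolynomial (Fin n) K) M] [IsScalarTower K (MvPolynomial (Fin n) K) M]
    {Z : Finset (Fin n)} {u x : M} :
    x ∈ stanleySpace (K := K) Z u ↔ ∃ f ∈ supported K (Z : Set (Fin n)), f • u = x :=
  Iff.rfl

/-- The class in `I / J` of a polynomial in `I`. -/
noncomputable def idealQuotMk (I J : Ideal (MvPolynomial (Fin n) K)) :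
    I →ₗ[MvPolynomial (Fin n) K] IdealQuot I J :=
  Submodule.mkQ _

theorem idealQuotMk_surjective : Function.Surjective (idealQuotMk I J) :=
  Submodule.mkQ_surjective _

theorem idealQuotMk_eq_zero {f : I} : idealQuotMk I J f = 0 ↔ (f : MvPolynomial (Fin n) K) ∈ J :=
  Submodule.Quotient.mk_eq_zero _

/-- The coefficient of `X^m`, for a monomial outside `J`, as a functional on `I / J`. -/
noncomputable def idealQuotCoeff (hJ : IsMonomialIdeal J) {m : Fin n →₀ ℕ} (hm : mono K m ∉ J) :
    IdealQuot I J →ₗ[K] K :=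
  (Submodule.liftQ ((Submodule.submoduleOf J I).restrictScalars K)
      ((lcoeff K m).comp (I.subtype.restrictScalars K))
      fun f hf => by
        by_contra h
        exact hm ((hJ _).1 hf m (mem_support_iff.2 h))).comp
    (Submodule.Quotient.restrictScalarsEquiv K (Submodule.submoduleOf J I)).symm.toLinearMap

theorem idealQuotCoeff_mk (hJ : IsMonomialIdeal J) {m : Fin n →₀ ℕ} (hm : mono K m ∉ J) (f : I) :
    idealQuotCoeff hJ hm (idealQuotMk I J f) = coeff m (f : MvPolynomial (Fin n) K) :=
  rfl

/-- An element of `I / J` vanishes if its coefficients at all monomials of `I \ J` do. -/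
theorem eq_zero_of_idealQuotCoeff_eq_zero (hI : IsMonomialIdeal I) (hJ : IsMonomialIdeal J)
    {x : IdealQuot I J}
    (hx : ∀ m, mono K m ∈ I → ∀ hm : mono K m ∉ J, idealQuotCoeff hJ hm x = 0) : x = 0 := by
  obtain ⟨f, rfl⟩ := idealQuotMk_surjective x
  refine idealQuotMk_eq_zero.2 ((hJ _).2 fun m hm => ?_)
  by_contra hmJ
  exact mem_support_iff.1 hm (hx m ((hI _).1 f.2 m hm) hmJ)

theorem eq_zero_of_mem_supported {Z : Finset (Fin n)} {f : MvPolynomial (Fin n) K}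
    (hf : f ∈ supported K (Z : Set (Fin n))) {m : Fin n →₀ ℕ} (hm : m ∈ f.support) {j : Fin n}
    (hj : j ∉ Z) : m j = 0 := by
  by_contra h
  exact hj (Finset.mem_coe.1 (mem_supported.1 hf
    (support_subset_vars_of_mem_support hm (Finsupp.mem_support_iff.2 h))))

theorem coeff_mul_mono_eq_zero {Z : Finset (Fin n)} {f : MvPolynomial (Fin n) K}
    (hf : f ∈ supported K (Z : Set (Fin n))) {a m : Fin n →₀ ℕ} (hm : m ∉ cone a Z) :
    coeff m (f * mono K a) = 0 := by
  rw [mono, coeff_mul_monomial', mul_one]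
  split_ifs with hle
  · by_contra h
    refine hm ⟨hle, fun j hj => ?_⟩
    have h0 : (m - a) j = 0 := eq_zero_of_mem_supported hf (mem_support_iff.2 h) hj
    have := hle j
    simp only [Finsupp.tsub_apply] at h0
    omega
  · rfl

theorem mono_mem_supported {Z : Finset (Fin n)} {b : Fin n →₀ ℕ} (hb : ∀ j ∉ Z, b j = 0) :
    mono K b ∈ supported K (Z : Set (Fin n)) := by
  rw [mem_supported, mono, vars_monomial one_ne_zero]
  intro j hj
  by_contra h
  exact Finsupp.mem_support_iff.1 hj (hb j h)

theorem exists_eq_add_of_mem_cone {Z : Finset (Fin n)} {a m : Fin n →₀ ℕ} (hm : m ∈ cone a Z) :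
    ∃ b : Fin n →₀ ℕ, (∀ j ∉ Z, b j = 0) ∧ m = b + a :=
  ⟨m - a, fun j hj => by simp [hm.2 j hj], (tsub_add_cancel_of_le hm.1).symm⟩

theorem smul_idealQuotMk_mono {a : Fin n →₀ ℕ} (ha : mono K a ∈ I) (f : MvPolynomial (Fin n) K) :
    f • idealQuotMk I J ⟨mono K a, ha⟩ =
      idealQuotMk I J ⟨f * mono K a, I.mul_mem_left f ha⟩ := rfl

theorem idealQuotCoeff_stanleySpace (hJ : IsMonomialIdeal J) {a m : Fin n →₀ ℕ}
    (ha : mono K a ∈ I) {Z : Finset (Fin n)} (hm : mono K m ∉ J) (hmc : m ∉ cone a Z)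
    {x : IdealQuot I J} (hx : x ∈ stanleySpace (K := K) Z (idealQuotMk I J ⟨mono K a, ha⟩)) :
    idealQuotCoeff hJ hm x = 0 := by
  obtain ⟨f, hf, rfl⟩ := mem_stanleySpace.1 hx
  rw [smul_idealQuotMk_mono, idealQuotCoeff_mk]
  exact coeff_mul_mono_eq_zero hf hmc

theorem idealQuotMk_mem_stanleySpace {a m : Fin n →₀ ℕ} (ha : mono K a ∈ I) {Z : Finset (Fin n)}
    (hm : m ∈ cone a Z) (hmI : mono K m ∈ I) : idealQuotMk I J ⟨mono K m, hmI⟩ ∈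
      stanleySpace (K := K) Z (idealQuotMk I J ⟨mono K a, ha⟩) := by
  obtain ⟨b, hb, rfl⟩ := exists_eq_add_of_mem_cone hm
  refine mem_stanleySpace.2 ⟨mono K b, mono_mem_supported hb, ?_⟩
  rw [smul_idealQuotMk_mono]
  congr 2
  simp [mono, monomial_mul]

theorem stanleySpace_smul {M : Type*} [AddCommGroup M] [Module K M]
    [Module (MvPolynomial (Fin n) K) M] [IsScalarTower K (MvPolynomial (Fin n) K) M]
    (Z : Finset (Fin n)) (u : M) {k : K} (hk : k ≠ 0) :
    stanleySpace (K := K) Z (k • u) = stanleySpace (K := K) Z u := by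
  ext x
  simp only [mem_stanleySpace]
  constructor
  · rintro ⟨f, hf, rfl⟩
    exact ⟨k • f, Subalgebra.smul_mem _ hf k, by rw [smul_assoc, smul_comm]⟩
  · rintro ⟨f, hf, rfl⟩
    refine ⟨k⁻¹ • f, Subalgebra.smul_mem _ hf _, ?_⟩
    rw [smul_assoc, smul_comm f, smul_smul, inv_mul_cancel₀ hk, one_smul]

/-- The exponent vectors of the monomials that form a `K`-basis of `I / J`. -/
def quotExponents (I J : Ideal (MvPolynomial (Fin n) K)) : Set (Fin n →₀ ℕ) :=
  {m | mono K m ∈ I ∧ mono K m ∉ J}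

/-- A nonzero homogeneous element of `I / J` is, up to a scalar, the class of a monomial. -/
theorem exists_eq_smul_mono {a : Fin n →₀ ℕ} {u : IdealQuot I J} (hu : u ∈ idealQuotGrading I J a)
    (h0 : u ≠ 0) : ∃ (ha : mono K a ∈ I) (k : K), k ≠ 0 ∧
      u = k • idealQuotMk I J ⟨mono K a, ha⟩ := by
  obtain ⟨⟨f, hf⟩, hfa, rfl⟩ := hu
  obtain ⟨k, rfl⟩ := Submodule.mem_span_singleton.1 (show f ∈ _ from hfa)
  have hk : k ≠ 0 := by
    rintro rfl
    refine h0 (idealQuotMk_eq_zero.2 ?_)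
    simp
  have ha : mono K a ∈ I := by
    have := I.mul_mem_left (C k⁻¹) hf
    rwa [← smul_eq_C_mul, smul_smul, inv_mul_cancel₀ hk, one_smul] at this
  exact ⟨ha, k, hk, rfl⟩

/-- The monomials in the summands of a Stanley decomposition of `I / J` partition the monomials of
`I` outside `J` into cones. -/
theorem IsStanleyDecomposition.hasConePartition (hJ : IsMonomialIdeal J) {r : ℕ}
    {Z : Fin r → Finset (Fin n)} {u : Fin r → IdealQuot I J}
    (h : IsStanleyDecomposition (idealQuotGrading I J) Z u) :
    HasConePartition (quotExponents I J) (⨅ i, ((Z i).card : ℕ∞)) := by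
  classical
  have hex : ∀ i, ∃ a, ∃ (ha : mono K a ∈ I) (k : K), k ≠ 0 ∧
      u i = k • idealQuotMk I J ⟨mono K a, ha⟩ := fun i => by
    obtain ⟨a, ha⟩ := h.homogeneous i
    refine ⟨a, exists_eq_smul_mono ha fun h0 => ?_⟩
    exact one_ne_zero (h.free i 1 (one_mem _) (by rw [h0, smul_zero]))
  choose a ha k hk hu using hex
  have hspace : ∀ i, stanleySpace (K := K) (Z i) (u i) =
      stanleySpace (K := K) (Z i) (idealQuotMk I J ⟨mono K (a i), ha i⟩) := fun i => by
    rw [hu i, stanleySpace_smul _ _ (hk i)]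
  have hsub : ∀ i, cone (a i) (Z i) ⊆ quotExponents I J := by
    intro i m hm
    refine ⟨mono_mem_of_le hm.1 (ha i), fun hmJ => ?_⟩
    obtain ⟨b, hb, rfl⟩ := exists_eq_add_of_mem_cone hm
    refine one_ne_zero (α := K) ?_
    have h0 := h.free i (mono K b) (mono_mem_supported hb) (by
      rw [hu i, smul_comm, smul_idealQuotMk_mono, idealQuotMk_eq_zero.2, smul_zero]
      simpa [mono, monomial_mul] using hmJ)
    simp [mono] at h0
  refine HasConePartition.of_pieces Finset.univ (B := fun i => cone (a i) (Z i)) (fun i _ => ?_)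
    (fun i _ => hsub i) fun m hm => ?_
  · refine ⟨{(a i, Z i)}, ?_, fun m hm => ⟨(a i, Z i), ?_⟩⟩
    · simpa using iInf_le (fun i => ((Z i).card : ℕ∞)) i
    · simpa using hm
  · have huniq : ∀ i i', m ∈ cone (a i) (Z i) → m ∈ cone (a i') (Z i') → i = i' := by
      intro i i' hi hi'
      by_contra hne
      have hdisj := h.isInternal.submodule_iSupIndep.pairwiseDisjoint hne
      refine hm.2 (idealQuotMk_eq_zero (f := ⟨mono K m, hm.1⟩).1
        ((Submodule.disjoint_def.1 hdisj) _ ?_ ?_))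
      · change _ ∈ stanleySpace _ _
        rw [hspace]
        exact idealQuotMk_mem_stanleySpace (ha i) hi hm.1
      · change _ ∈ stanleySpace _ _
        rw [hspace]
        exact idealQuotMk_mem_stanleySpace (ha i') hi' hm.1
    have hexm : ∃ i, m ∈ cone (a i) (Z i) := by
      by_contra! hno
      have hle : (⨆ i, stanleySpace (K := K) (Z i) (u i)) ≤
          LinearMap.ker (idealQuotCoeff (I := I) hJ hm.2) := iSup_le fun i x hx => by
        rw [hspace] at hx
        exact idealQuotCoeff_stanleySpace hJ (ha i) hm.2 (hno i) hx
      rw [h.isInternal.submodule_iSup_eq_top] at hle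
      have h1 : idealQuotCoeff hJ hm.2 (idealQuotMk I J ⟨mono K m, hm.1⟩) = 0 := hle trivial
      rw [idealQuotCoeff_mk] at h1
      simp [mono] at h1
    obtain ⟨i, hi⟩ := hexm
    exact ⟨i, ⟨Finset.mem_univ i, hi⟩, fun i' hi' => huniq i' i hi'.2 hi⟩

/-- A partition of the monomials of `I` outside `J` into cones of dimension at least `d` gives a
Stanley decomposition of `I / J`. -/
theorem HasConePartition.le_sdepth (hI : IsMonomialIdeal I) (hJ : IsMonomialIdeal J) {d : ℕ∞}
    (h : HasConePartition (quotExponents I J) d) : d ≤ sdepth I J := by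
  classical
  obtain ⟨P, hP, hPA⟩ := h
  let e := P.equivFin.symm
  let a : Fin P.card → (Fin n →₀ ℕ) := fun i => (e i).1.1
  let Z : Fin P.card → Finset (Fin n) := fun i => (e i).1.2
  have hsub : ∀ i, cone (a i) (Z i) ⊆ quotExponents I J := fun i => (hP _ (e i).2).2
  have ha : ∀ i, mono K (a i) ∈ I := fun i => (hsub i (self_mem_cone _ _)).1
  let u : Fin P.card → IdealQuot I J := fun i => idealQuotMk I J ⟨mono K (a i), ha i⟩
  have hcoeff : ∀ i m (hm : mono K m ∉ J), m ∉ cone (a i) (Z i) →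
      stanleySpace (K := K) (Z i) (u i) ≤ LinearMap.ker (idealQuotCoeff (I := I) hJ hm) :=
    fun i m hm hmi x hx => idealQuotCoeff_stanleySpace hJ (ha i) hm hmi hx
  have hdec : IsStanleyDecomposition (idealQuotGrading I J) Z u := by
    refine ⟨fun i => ⟨a i, ⟨_, ?_, rfl⟩⟩, fun i f hf hfu => ?_, ?_⟩
    · exact Submodule.mem_span_singleton_self (mono K (a i))
    · rw [smul_idealQuotMk_mono, idealQuotMk_eq_zero, hJ.mul_mono_mem] at hfu
      by_contra hf0
      obtain ⟨m, hm⟩ := support_nonempty.2 hf0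
      refine (hsub i ⟨le_add_self, fun j hj => ?_⟩).2 (hfu m hm)
      simp [eq_zero_of_mem_supported hf hm hj]
    · refine DirectSum.isInternal_submodule_of_iSupIndep_of_iSup_eq_top ?_ ?_
      · refine fun i => Submodule.disjoint_def.2 fun x hx hx' => ?_
        refine eq_zero_of_idealQuotCoeff_eq_zero hI hJ fun m hmI hmJ => ?_
        by_cases hmi : m ∈ cone (a i) (Z i)
        · have hle : (⨆ (i') (_ : i' ≠ i), stanleySpace (K := K) (Z i') (u i')) ≤
              LinearMap.ker (idealQuotCoeff (I := I) hJ hmJ) := by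
            refine iSup₂_le fun i' hi' => hcoeff i' m hmJ fun hmi' => hi' ?_
            have := (hPA m ⟨hmI, hmJ⟩).unique ⟨(e i').2, hmi'⟩ ⟨(e i).2, hmi⟩
            exact e.injective (Subtype.ext this)
          exact hle hx'
        · exact hcoeff i m hmJ hmi hx
      · refine eq_top_iff.2 fun x _ => ?_
        obtain ⟨⟨f, hf⟩, rfl⟩ := idealQuotMk_surjective x
        have hmem : ∀ m ∈ f.support, mono K m ∈ I := (hI f).1 hf
        have hsum : (⟨f, hf⟩ : I) =
            ∑ m ∈ f.support.attach, coeff m.1 f • ⟨mono K m.1, hmem m.1 m.2⟩ := by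
          ext1
          rw [AddSubmonoidClass.coe_finsetSum]
          refine Eq.trans ?_ (Finset.sum_attach f.support fun m => coeff m f • mono K m).symm
          simp [mono, smul_monomial]
        have hmap : ∀ (k : K) (g : I), idealQuotMk I J (k • g) = k • idealQuotMk I J g :=
          fun _ _ => rfl
        rw [hsum, map_sum]
        refine Submodule.sum_mem _ fun m _ => ?_
        rw [hmap]
        refine Submodule.smul_mem _ _ ?_
        by_cases hmJ : mono K m.1 ∈ J
        · rw [idealQuotMk_eq_zero.2 hmJ]
          exact Submodule.zero_mem _
        · obtain ⟨p, ⟨hp, hmp⟩, -⟩ := hPA m.1 ⟨hmem m.1 m.2, hmJ⟩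
          refine Submodule.mem_iSup_of_mem (e.symm ⟨p, hp⟩)
            (idealQuotMk_mem_stanleySpace (ha _) ?_ _)
          simpa [a, Z] using hmp
  refine le_trans (le_iInf fun i => (hP _ (e i).2).1) (le_sSup ⟨P.card, Z, u, hdec, rfl⟩)

end Translation
end Stanley

/-! ### Deformations, and the Stanley depth of generic ideals -/

namespace Stanley

open MvPolynomial

/-- The coordinatewise monotone map `ℕ^n → ℕ^n` along which membership in the monomial ideals
deformed by `ε` pulls back to membership in the original ones: its `j`-th coordinate sends
`t` to the largest deformed `j`-th exponent of those members of `G` whose `j`-th exponent is at most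
`t`, and to `0` if there are none. -/
noncomputable def deformMap {n : ℕ} (ε : (Fin n →₀ ℕ) → (Fin n →₀ ℕ)) (G : Finset (Fin n →₀ ℕ))
    (m : Fin n →₀ ℕ) : Fin n →₀ ℕ :=
  Finsupp.equivFunOnFinite.symm fun j =>
    (G.filter fun a => a j ≤ m j).sup fun a => a j + ε a j

section Deformation

variable {n : ℕ} {ε : (Fin n →₀ ℕ) → (Fin n →₀ ℕ)} {G : Finset (Fin n →₀ ℕ)}

theorem deformMap_apply (m : Fin n →₀ ℕ) (j : Fin n) :
    deformMap ε G m j = (G.filter fun a => a j ≤ m j).sup fun a => a j + ε a j := rfl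

theorem IsDeformation.add_le_deformMap_iff (hε : IsDeformation G ε) {g : Fin n →₀ ℕ} (hg : g ∈ G)
    {m : Fin n →₀ ℕ} : g + ε g ≤ deformMap ε G m ↔ g ≤ m := by
  constructor
  · intro h j
    by_contra! hj
    have h1 := h j
    rw [deformMap_apply, Finsupp.add_apply, Finset.le_sup_iff (by simp; omega)] at h1
    obtain ⟨a, ha, hle⟩ := h1
    obtain ⟨haG, haj⟩ := Finset.mem_filter.1 ha
    exact absurd (hε.1 g hg a haG j (haj.trans_lt hj)) (not_lt.2 hle)
  · intro h j
    rw [deformMap_apply]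
    exact Finset.le_sup (f := fun a : Fin n →₀ ℕ => a j + ε a j)
      (Finset.mem_filter.2 ⟨hg, h j⟩)

theorem IsDeformation.mono_deformMap_mem (K : Type*) [Field K] (hε : IsDeformation G ε)
    {G' : Finset (Fin n →₀ ℕ)} (hG' : G' ⊆ G) (m : Fin n →₀ ℕ) :
    mono K (deformMap ε G m) ∈ monomialIdeal K (deform ε G') ↔
      mono K m ∈ monomialIdeal K G' := by
  rw [mono_mem_monomialIdeal, mono_mem_monomialIdeal]
  simp only [deform, Finset.exists_mem_image]
  exact exists_congr fun g => and_congr_right fun hg => hε.add_le_deformMap_iff (hG' hg)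

theorem HasConePartition.preimage_deformMap {A : Set (Fin n →₀ ℕ)} {d : ℕ∞}
    (h : HasConePartition A d) : HasConePartition (deformMap ε G ⁻¹' A) d :=
  h.preimage (ψ := fun j t => (G.filter fun a => a j ≤ t).sup fun a => a j + ε a j)
    (fun _ _ _ hst => Finset.sup_mono fun _ ha =>
      Finset.mem_filter.2 ⟨(Finset.mem_filter.1 ha).1, (Finset.mem_filter.1 ha).2.trans hst⟩)
    fun m j => deformMap_apply m j

end Deformation

/-- For a generic monomial ideal, the monomials outside it are partitioned by cones of dimension
at least `depth S / I`. -/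
theorem IsGeneric.hasConePartition {K : Type*} [Field K] {n : ℕ} {G : Finset (Fin n →₀ ℕ)}
    (h : IsGeneric (monomialIdeal K G)) :
    HasConePartition (quotExponents ⊤ (monomialIdeal K G))
      (depth K n (MvPolynomial (Fin n) K ⧸ monomialIdeal K G)) := by
  set I := monomialIdeal K G
  let U : Set (Fin n →₀ ℕ) := {m | mono K m ∈ I}
  have hUc : quotExponents ⊤ I = Uᶜ := by
    ext m
    simp [quotExponents, U]
  let D : ℕ := G.sup fun g => Finset.univ.sup g
  have hD : ∀ g ∈ G, ∀ j, g j ≤ D := fun g hg j =>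
    (Finset.le_sup (Finset.mem_univ j)).trans
      (Finset.le_sup (f := fun g : Fin n →₀ ℕ => Finset.univ.sup g) hg)
  have hgen : GenericSet U := by
    intro a b ha hb hab j hj h0
    obtain ⟨c, hc, -, -, hcs⟩ := h a ha b hb hab ⟨j, hj, h0⟩
    have hpos : 0 < (a ⊔ b) j := h0.trans_le (le_sup_left (a := a) (b := b) j)
    refine ⟨c, hc.1, (hcs j hpos).trans tsub_le_self, ?_⟩
    have := hcs j hpos j
    simp only [Finsupp.tsub_apply, Finsupp.single_eq_same] at this
    omega
  rw [hUc]
  refine hgen.hasConePartition_compl (D := D)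
    (fun a b hab ha => show mono K b ∈ I from mono_mem_of_le hab ha)
    (fun b hb => ?_) fun a ha => ?_
  · obtain ⟨g, hg, hgb⟩ := mono_mem_monomialIdeal.1 hb
    exact ⟨g, mono_mem_monomialIdeal.2 ⟨g, hg, le_rfl⟩, hgb, hD g hg⟩
  · refine depth_quotient_le_card (isMonomialIdeal_monomialIdeal G) (a := a) (fun j hj => ?_)
      fun m hm hmem => ?_
    · exact ha.2.2 j (lt_of_le_of_ne (ha.2.1 j) (by simpa using hj))
    · obtain ⟨g, hg, hgm⟩ := mono_mem_monomialIdeal.1 hmem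
      refine ha.1 (mono_mem_monomialIdeal.2 ⟨g, hg, fun j => ?_⟩)
      by_cases hj : a j = D
      · exact hj ▸ hD g hg j
      · have := hgm j
        rwa [Finsupp.add_apply, hm j (by simpa using hj), add_zero] at this

end Stanley

theorem mainTheorem10 {K : Type*} [Field K] (n : ℕ) :
    (∀ (I J : Ideal (MvPolynomial (Fin n) K)) (GI GJ : Finset (Fin n →₀ ℕ))
        (ε : (Fin n →₀ ℕ) → (Fin n →₀ ℕ)),
        I = Stanley.monomialIdeal K GI → J = Stanley.monomialIdeal K GJ → J < I →
        Stanley.IsDeformation (GI ∪ GJ) ε →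
        Stanley.monomialIdeal K (Stanley.deform ε GJ) ≤
          Stanley.monomialIdeal K (Stanley.deform ε GI) →
        Stanley.monomialIdeal K (Stanley.deform ε GJ) <
            Stanley.monomialIdeal K (Stanley.deform ε GI) ∧
          Stanley.sdepth I J ≥
            Stanley.sdepth (Stanley.monomialIdeal K (Stanley.deform ε GI))
              (Stanley.monomialIdeal K (Stanley.deform ε GJ))) ∧
    (∀ (I : Ideal (MvPolynomial (Fin n) K)) (G : Finset (Fin n →₀ ℕ))
        (ε : (Fin n →₀ ℕ) → (Fin n →₀ ℕ)),
        I = Stanley.monomialIdeal K G → I ≠ ⊤ →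
        Stanley.IsDeformation G ε →
        Stanley.IsGeneric (Stanley.monomialIdeal K (Stanley.deform ε G)) →
        Stanley.depth K n (MvPolynomial (Fin n) K ⧸ I) =
          Stanley.depth K n
            (MvPolynomial (Fin n) K ⧸ Stanley.monomialIdeal K (Stanley.deform ε G)) →
        Stanley.sdepth ⊤ I ≥ Stanley.depth K n (MvPolynomial (Fin n) K ⧸ I)) := by
  classical
  refine ⟨?_, ?_⟩
  · rintro I J GI GJ ε rfl rfl hlt hε hle
    have hI := hε.mono_deformMap_mem K (Finset.subset_union_left (s₁ := GI) (s₂ := GJ))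
    have hJ := hε.mono_deformMap_mem K (Finset.subset_union_right (s₁ := GI) (s₂ := GJ))
    refine ⟨lt_of_le_not_ge hle fun hge => not_le_of_gt hlt fun f hf => ?_, ?_⟩
    · refine (Stanley.isMonomialIdeal_monomialIdeal GJ f).2 fun m hm => ?_
      exact (hJ m).1 (hge ((hI m).2 ((Stanley.isMonomialIdeal_monomialIdeal GI f).1 hf m hm)))
    · refine sSup_le ?_
      rintro d ⟨r, Z, u, hdec, rfl⟩
      have h := (hdec.hasConePartition
        (Stanley.isMonomialIdeal_monomialIdeal _)).preimage_deformMap (ε := ε) (G := GI ∪ GJ)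
      refine Stanley.HasConePartition.le_sdepth (Stanley.isMonomialIdeal_monomialIdeal _)
        (Stanley.isMonomialIdeal_monomialIdeal _) ?_
      convert! h using 1
      ext m
      exact (and_congr (hI m) (not_congr (hJ m))).symm
  · rintro I G ε rfl - hε hgen hdepth
    rw [hdepth]
    have h := hgen.hasConePartition.preimage_deformMap (ε := ε) (G := G)
    refine Stanley.HasConePartition.le_sdepth Stanley.isMonomialIdeal_top
      (Stanley.isMonomialIdeal_monomialIdeal _) ?_
    convert! h using 1
    ext m
    exact (and_congr (by simp) (not_congr (hε.mono_deformMap_mem K subset_rfl m))).symm
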